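/- **Setting.** A *category with homotopies* is a category $\mathbf A$ with, for all objects $X,Y$, homotopies $\alpha: f\simeq g: X\to Y$ between maps, with: trivial homotopies $0_f: f\simeq f$; a strictly associative and unital whisker composition $v\cdot\alpha\cdot u$ with maps, which takes trivial homotopies to trivial ones; reverses $-\alpha: g\simeq f$ and concatenations $\alpha+\beta: f\simeq h$ (for $\alpha:f\simeq g$, $\beta:g\simeq h$); and an equivalence relation $\simeq_2$ between parallel homotopies, compatible with all these operations, up to which concatenation satisfies the groupoid axioms, whiskering preserves sums and reverses, and the reduced interchange $g\alpha+\beta f'\simeq_2\beta f+g'\alpha$ holds for all $\alpha: f\simeq f': X\to Y$, $\beta: g\simeq g': Y\to Z$. $\mathbf A$ is *pointed homotopical* if moreover: - it has an object $0$ such that each object $X$ has exactly one map $X\to 0$ and exactly one homotopy of this map to itself, and dually for $0\to X$ (the zero maps are also denoted by $0$); - each map $f:X\to Y$ has a (chosen) h-kernel $(Kf,\ kf: Kf\to X,\ \kappa f: 0\simeq f\cdot kf)$: for all $x:W\to X$ and $\xi:0\simeq fx$ there is a unique $u:W\to Kf$ with $kf\cdot u=x$ and $\kappa f\cdot u=\xi$;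 and for all $a,b:W\to Kf$ and $\varphi: kf\cdot a\simeq kf\cdot b$ with $\kappa f\cdot a+f\varphi\simeq_2\kappa f\cdot b$ there is some $\psi:a\simeq b$ with $kf\cdot\psi=\varphi$; - dually, each map $f:X\to Y$ has a (chosen) h-cokernel $(Cf,\ cf:Y\to Cf,\ \gamma f:0\simeq cf\cdot f)$. Let $\Omega Y=K(0\to Y)$ and $\Sigma X=C(X\to 0)$, which define functors $\Sigma\dashv\Omega$. An object is *contractible* if its identity is homotopic to the zero map. Let $\mathbf A$ be a pointed homotopical category and $p\ge 0$ an integer such that $\Omega^{p+1}X$ and $\Sigma^{p+1}X$ are contractible (for instance, zero) for every object $X$. Let $\mathbf D$ be an abelian category and let $H_n:\mathbf A\to\mathbf D$ ($0\le n\le p$) be functors such that: 1. $H_n(f)=H_n(g)$ whenever $f\simeq g$; 2. for every map $f:A\to B$, the sequences $H_0(Kf)\to H_0(A)\to H_0(B)$ and $H_p(A)\to H_p(B)\to H_p(Cf)$ are exact; 3. there are natural isomorphisms $\omega: H_n(\Omega A)\to H_{n+1}(A)$ and $\sigma: H_n(A)\to H_{n+1}(\Sigma A)$ for $0\le n<p$,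 such that $\omega_{\Sigma A}\circ H_n(u_A)=\sigma_A$ and $H_{n+1}(v_A)\circ\sigma_{\Omega A}=\omega_A$, where $u_A:A\to\Omega\Sigma A$ and $v_A:\Sigma\Omega A\to A$ are the unit and counit of $\Sigma\dashv\Omega$. A map $f$ of $\mathbf A$ is a *weak equivalence* if $H_n(f)$ is an isomorphism for all $0\le n\le p$. **Lemma 3.8.** Let $f:X\to A$ and $g:A\to Y$ be maps of $\mathbf A$ and let $\alpha:0\simeq gf$. Let $u_\alpha:X\to Kg$ be the map with $kg\cdot u_\alpha=f$, $\kappa g\cdot u_\alpha=\alpha$, and let $v_\alpha:Cf\to Y$ be the map with $v_\alpha\cdot cf=g$, $v_\alpha\cdot\gamma f=\alpha$. Then there exists a comparison map from left to right homotopical homology, i.e. a map $i:Cu_\alpha\to Kv_\alpha$ such that $$kv_\alpha\cdot i\cdot cu_\alpha=cf\cdot kg,\qquad kv_\alpha\cdot i\cdot\gamma u_\alpha=\gamma f,\qquad \kappa v_\alpha\cdot i\cdot cu_\alpha=\kappa g,$$ and every such map $i$ is a weak equivalence. -/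

import Mathlib

open CategoryTheory

universe w v u v' u'

/-- A category with homotopies. Each hom-set carries a reflexive graph of homotopies
(`Htpy X Y`, with faces `dom`, `cod` and trivial homotopies `triv f = 0_f`), on which maps act
strictly by whiskering (`pre u α` is `α.u`, `post α v` is `v.α`). Homotopies have reverses
`rev α = -α` and concatenations `concat α β = α + β` (defined when `cod α = dom β`). There is an
equivalence relation `Two` (2-homotopy) between parallel homotopies, compatible with all the
operations, up to which the vertical structure is a groupoid, whiskering is functorial, and the
reduced interchange property holds. Thus the quotient by `Two` is a groupoid-enriched category,
the track 2-category. -/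
class HCategory (C : Type u) [Category.{v} C] where
  Htpy : C → C → Type w
  dom : ∀ {X Y : C}, Htpy X Y → (X ⟶ Y)
  cod : ∀ {X Y : C}, Htpy X Y → (X ⟶ Y)
  triv : ∀ {X Y : C}, (X ⟶ Y) → Htpy X Y
  pre : ∀ {X' X Y : C}, (X' ⟶ X) → Htpy X Y → Htpy X' Y
  post : ∀ {X Y Y' : C}, Htpy X Y → (Y ⟶ Y') → Htpy X Y'
  rev : ∀ {X Y : C}, Htpy X Y → Htpy X Y
  concat : ∀ {X Y : C} (α β : Htpy X Y), cod α = dom β → Htpy X Y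
  Two : ∀ {X Y : C}, Htpy X Y → Htpy X Y → Prop
  dom_triv : ∀ {X Y : C} (f : X ⟶ Y), dom (triv f) = f
  cod_triv : ∀ {X Y : C} (f : X ⟶ Y), cod (triv f) = f
  dom_pre : ∀ {X' X Y : C} (r : X' ⟶ X) (α : Htpy X Y), dom (pre r α) = r ≫ dom α
  cod_pre : ∀ {X' X Y : C} (r : X' ⟶ X) (α : Htpy X Y), cod (pre r α) = r ≫ cod α
  dom_post : ∀ {X Y Y' : C} (α : Htpy X Y) (s : Y ⟶ Y'), dom (post α s) = dom α ≫ s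
  cod_post : ∀ {X Y Y' : C} (α : Htpy X Y) (s : Y ⟶ Y'), cod (post α s) = cod α ≫ s
  dom_rev : ∀ {X Y : C} (α : Htpy X Y), dom (rev α) = cod α
  cod_rev : ∀ {X Y : C} (α : Htpy X Y), cod (rev α) = dom α
  dom_concat : ∀ {X Y : C} (α β : Htpy X Y) (h : cod α = dom β), dom (concat α β h) = dom α
  cod_concat : ∀ {X Y : C} (α β : Htpy X Y) (h : cod α = dom β), cod (concat α β h) = cod β
  pre_id : ∀ {X Y : C} (α : Htpy X Y), pre (𝟙 X) α = α
  pre_comp : ∀ {X'' X' X Y : C} (r' : X'' ⟶ X') (r : X' ⟶ X) (α : Htpy X Y),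
    pre (r' ≫ r) α = pre r' (pre r α)
  post_id : ∀ {X Y : C} (α : Htpy X Y), post α (𝟙 Y) = α
  post_comp : ∀ {X Y Y' Y'' : C} (α : Htpy X Y) (s : Y ⟶ Y') (s' : Y' ⟶ Y''),
    post α (s ≫ s') = post (post α s) s'
  pre_post : ∀ {X' X Y Y' : C} (r : X' ⟶ X) (α : Htpy X Y) (s : Y ⟶ Y'),
    pre r (post α s) = post (pre r α) s
  pre_triv : ∀ {X' X Y : C} (r : X' ⟶ X) (f : X ⟶ Y), pre r (triv f) = triv (r ≫ f)
  post_triv : ∀ {X Y Y' : C} (f : X ⟶ Y) (s : Y ⟶ Y'), post (triv f) s = triv (f ≫ s)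
  two_equivalence : ∀ X Y : C, Equivalence (Two (X := X) (Y := Y))
  two_dom : ∀ {X Y : C} {α β : Htpy X Y}, Two α β → dom α = dom β
  two_cod : ∀ {X Y : C} {α β : Htpy X Y}, Two α β → cod α = cod β
  two_pre : ∀ {X' X Y : C} (r : X' ⟶ X) {α β : Htpy X Y}, Two α β → Two (pre r α) (pre r β)
  two_post : ∀ {X Y Y' : C} {α β : Htpy X Y} (s : Y ⟶ Y'), Two α β → Two (post α s) (post β s)
  two_rev : ∀ {X Y : C} {α β : Htpy X Y}, Two α β → Two (rev α) (rev β)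
  two_concat : ∀ {X Y : C} {α α' β β' : Htpy X Y} (h : cod α = dom β) (h' : cod α' = dom β'),
    Two α α' → Two β β' → Two (concat α β h) (concat α' β' h')
  triv_concat : ∀ {X Y : C} (α : Htpy X Y),
    Two (concat (triv (dom α)) α (cod_triv _)) α
  concat_triv : ∀ {X Y : C} (α : Htpy X Y),
    Two (concat α (triv (cod α)) (dom_triv _).symm) α
  concat_assoc : ∀ {X Y : C} (α β δ : Htpy X Y) (h : cod α = dom β) (h' : cod β = dom δ),
    Two (concat (concat α β h) δ ((cod_concat α β h).trans h'))
      (concat α (concat β δ h') (h.trans (dom_concat β δ h').symm))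
  concat_rev : ∀ {X Y : C} (α : Htpy X Y),
    Two (concat α (rev α) (dom_rev α).symm) (triv (dom α))
  rev_concat : ∀ {X Y : C} (α : Htpy X Y),
    Two (concat (rev α) α (cod_rev α)) (triv (cod α))
  pre_concat : ∀ {X' X Y : C} (r : X' ⟶ X) (α β : Htpy X Y) (h : cod α = dom β),
    Two (pre r (concat α β h))
      (concat (pre r α) (pre r β) (by rw [cod_pre, dom_pre, h]))
  post_concat : ∀ {X Y Y' : C} (α β : Htpy X Y) (s : Y ⟶ Y') (h : cod α = dom β),
    Two (post (concat α β h) s)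
      (concat (post α s) (post β s) (by rw [cod_post, dom_post, h]))
  pre_rev : ∀ {X' X Y : C} (r : X' ⟶ X) (α : Htpy X Y), Two (pre r (rev α)) (rev (pre r α))
  post_rev : ∀ {X Y Y' : C} (α : Htpy X Y) (s : Y ⟶ Y'), Two (post (rev α) s) (rev (post α s))
  /-- Reduced interchange: `g.α + β.f' ≃₂ β.f + g'.α` for `α : f ≃ f'` and `β : g ≃ g'`. -/
  interchange : ∀ {X Y Z : C} (α : Htpy X Y) (β : Htpy Y Z),
    Two (concat (post α (dom β)) (pre (cod α) β) (by rw [cod_post, dom_pre]))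
      (concat (pre (dom α) β) (post α (cod β)) (by rw [cod_pre, dom_post]))

/-- A category with homotopies and a zero object in the 2-dimensional sense: every `X` has exactly
one map to (and from) the zero object, and exactly one homotopy of that map with itself. -/
class PointedHCategory (C : Type u) [Category.{v} C] extends HCategory.{w} C where
  zeroObj : C
  isZero_zeroObj : Limits.IsZero zeroObj
  htpy_to_zero : ∀ {X : C} (α : Htpy X zeroObj), α = triv (isZero_zeroObj.from_ X)
  htpy_from_zero : ∀ {X : C} (α : Htpy zeroObj X), α = triv (isZero_zeroObj.to_ X)

open HCategory PointedHCategory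

namespace Homotopical

section Pointed

variable {C : Type u} [Category.{v} C] [PointedHCategory.{w} C]

/-- The unique map to the zero object. -/
noncomputable def toZero (X : C) : X ⟶ zeroObj (C := C) := isZero_zeroObj.from_ X

/-- The unique map from the zero object. -/
noncomputable def fromZero (X : C) : zeroObj (C := C) ⟶ X := isZero_zeroObj.to_ X

/-- The zero map. -/
noncomputable def zeroMap (X Y : C) : X ⟶ Y := toZero X ≫ fromZero Y

theorem comp_toZero {X Y : C} (r : X ⟶ Y) : r ≫ toZero Y = toZero X :=
  isZero_zeroObj.eq_of_tgt _ _

theorem fromZero_comp {X Y : C} (r : X ⟶ Y) : fromZero X ≫ r = fromZero Y :=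
  isZero_zeroObj.eq_of_src _ _

theorem comp_zeroMap {X Y : C} (r : X ⟶ Y) (Z : C) : r ≫ zeroMap Y Z = zeroMap X Z := by
  rw [zeroMap, ← Category.assoc, comp_toZero, zeroMap]

theorem zeroMap_comp (X : C) {Y Z : C} (r : Y ⟶ Z) : zeroMap X Y ≫ r = zeroMap X Z := by
  rw [zeroMap, Category.assoc, fromZero_comp, zeroMap]

theorem map_to_zero {X : C} (r : X ⟶ zeroObj (C := C)) : r = toZero X :=
  isZero_zeroObj.eq_of_tgt _ _

theorem map_from_zero {X : C} (r : zeroObj (C := C) ⟶ X) : r = fromZero X :=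
  isZero_zeroObj.eq_of_src _ _

/-- `α` is a nullhomotopy `0 ≃ f`. -/
def IsNullhomotopy {X Y : C} (α : Htpy X Y) (f : X ⟶ Y) : Prop :=
  dom α = zeroMap X Y ∧ cod α = f

theorem IsNullhomotopy.pre {X' X Y : C} {α : Htpy X Y} {f : X ⟶ Y} (h : IsNullhomotopy α f)
    (r : X' ⟶ X) : IsNullhomotopy (HCategory.pre r α) (r ≫ f) :=
  ⟨by rw [dom_pre, h.1, comp_zeroMap], by rw [cod_pre, h.2]⟩

theorem IsNullhomotopy.post {X Y Y' : C} {α : Htpy X Y} {f : X ⟶ Y} (h : IsNullhomotopy α f)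
    (s : Y ⟶ Y') : IsNullhomotopy (HCategory.post α s) (f ≫ s) :=
  ⟨by rw [dom_post, h.1, zeroMap_comp], by rw [cod_post, h.2]⟩

/-- A homotopy kernel `(Kf, kf, κf)` of `f`, with its 1- and 2-dimensional universal properties. -/
structure HKernel {X Y : C} (f : X ⟶ Y) where
  K : C
  k : K ⟶ X
  κ : Htpy K Y
  isNull : IsNullhomotopy κ (k ≫ f)
  existsUnique_lift : ∀ {W : C} (x : W ⟶ X) (ξ : Htpy W Y), IsNullhomotopy ξ (x ≫ f) →
    ∃! r : W ⟶ K, r ≫ k = x ∧ pre r κ = ξ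
  /-- A homotopy `φ : kf.a ≃ kf.b` which is coherent with `κf`, i.e. `κf.a + f.φ ≃₂ κf.b`, lifts
  to some homotopy `ψ : a ≃ b` with `kf.ψ = φ`. -/
  exists_lift₂ : ∀ {W : C} (a b : W ⟶ K) (φ : Htpy W X) (ha : dom φ = a ≫ k)
    (_ : cod φ = b ≫ k),
    Two (concat (pre a κ) (post φ f)
      (by rw [cod_pre, dom_post, isNull.2, ha, Category.assoc])) (pre b κ) →
    ∃ ψ : Htpy W K, dom ψ = a ∧ cod ψ = b ∧ post ψ k = φ

/-- A homotopy cokernel `(Cf, cf, γf)` of `f`, with its 1- and 2-dimensional universal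
properties. -/
structure HCokernel {X Y : C} (f : X ⟶ Y) where
  C' : C
  c : Y ⟶ C'
  γ : Htpy X C'
  isNull : IsNullhomotopy γ (f ≫ c)
  existsUnique_desc : ∀ {Z : C} (z : Y ⟶ Z) (ζ : Htpy X Z), IsNullhomotopy ζ (f ≫ z) →
    ∃! s : C' ⟶ Z, c ≫ s = z ∧ post γ s = ζ
  /-- A homotopy `φ : a.cf ≃ b.cf` which is coherent with `γf`, i.e. `a.γf + φ.f ≃₂ b.γf`, extends
  to some homotopy `ψ : a ≃ b` with `ψ.cf = φ`. -/
  exists_desc₂ : ∀ {Z : C} (a b : C' ⟶ Z) (φ : Htpy Y Z) (ha : dom φ = c ≫ a)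
    (_ : cod φ = c ≫ b),
    Two (concat (post γ a) (pre f φ)
      (by rw [cod_post, dom_pre, isNull.2, ha, Category.assoc])) (post γ b) →
    ∃ ψ : Htpy C' Z, dom ψ = a ∧ cod ψ = b ∧ pre c ψ = φ

/-- An object is contractible if its identity is homotopic to zero. -/
def Contractible (X : C) : Prop :=
  ∃ α : Htpy X X, dom α = 𝟙 X ∧ cod α = zeroMap X X

end Pointed

end Homotopical

open Homotopical

/-- A pointed homotopical category: a pointed category with homotopies, equipped with (standard)
homotopy kernels and homotopy cokernels of all maps. -/
class PointedHomotopicalCategory (C : Type u) [Category.{v} C] extends PointedHCategory.{w} C where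
  hker : ∀ {X Y : C} (f : X ⟶ Y), HKernel f
  hcok : ∀ {X Y : C} (f : X ⟶ Y), HCokernel f

namespace Homotopical

section Defs

variable {C : Type u} [Category.{v} C] [PointedHomotopicalCategory.{w} C]

/-- The object `Kf`. -/
abbrev K {X Y : C} (f : X ⟶ Y) : C := (PointedHomotopicalCategory.hker f).K

/-- The map `kf : Kf ⟶ X`. -/
abbrev k {X Y : C} (f : X ⟶ Y) : K f ⟶ X := (PointedHomotopicalCategory.hker f).k

/-- The nullhomotopy `κf : 0 ≃ f.kf`. -/
abbrev κ {X Y : C} (f : X ⟶ Y) : Htpy (K f) Y := (PointedHomotopicalCategory.hker f).κ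

theorem κ_isNull {X Y : C} (f : X ⟶ Y) : IsNullhomotopy (κ f) (k f ≫ f) :=
  (PointedHomotopicalCategory.hker f).isNull

theorem existsUnique_lift {X Y W : C} (f : X ⟶ Y) (x : W ⟶ X) (ξ : Htpy W Y)
    (h : IsNullhomotopy ξ (x ≫ f)) : ∃! r : W ⟶ K f, r ≫ k f = x ∧ pre r (κ f) = ξ :=
  (PointedHomotopicalCategory.hker f).existsUnique_lift x ξ h

/-- The object `Cf`. -/
abbrev Cok {X Y : C} (f : X ⟶ Y) : C := (PointedHomotopicalCategory.hcok f).C'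

/-- The map `cf : Y ⟶ Cf`. -/
abbrev c {X Y : C} (f : X ⟶ Y) : Y ⟶ Cok f := (PointedHomotopicalCategory.hcok f).c

/-- The nullhomotopy `γf : 0 ≃ cf.f`. -/
abbrev γ {X Y : C} (f : X ⟶ Y) : Htpy X (Cok f) := (PointedHomotopicalCategory.hcok f).γ

theorem γ_isNull {X Y : C} (f : X ⟶ Y) : IsNullhomotopy (γ f) (f ≫ c f) :=
  (PointedHomotopicalCategory.hcok f).isNull

theorem existsUnique_desc {X Y Z : C} (f : X ⟶ Y) (z : Y ⟶ Z) (ζ : Htpy X Z)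
    (h : IsNullhomotopy ζ (f ≫ z)) : ∃! s : Cok f ⟶ Z, c f ≫ s = z ∧ post (γ f) s = ζ :=
  (PointedHomotopicalCategory.hcok f).existsUnique_desc z ζ h

/-- The map `r : W ⟶ Kf` with `kf.r = x` and `κf.r = ξ`. -/
noncomputable def lift {X Y W : C} (f : X ⟶ Y) (x : W ⟶ X) (ξ : Htpy W Y)
    (h : IsNullhomotopy ξ (x ≫ f)) : W ⟶ K f :=
  (existsUnique_lift f x ξ h).choose

theorem lift_k {X Y W : C} (f : X ⟶ Y) (x : W ⟶ X) (ξ : Htpy W Y)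
    (h : IsNullhomotopy ξ (x ≫ f)) : lift f x ξ h ≫ k f = x :=
  (existsUnique_lift f x ξ h).choose_spec.1.1

theorem pre_lift_κ {X Y W : C} (f : X ⟶ Y) (x : W ⟶ X) (ξ : Htpy W Y)
    (h : IsNullhomotopy ξ (x ≫ f)) : pre (lift f x ξ h) (κ f) = ξ :=
  (existsUnique_lift f x ξ h).choose_spec.1.2

theorem K_hom_ext {X Y W : C} {f : X ⟶ Y} {a b : W ⟶ K f} (h : a ≫ k f = b ≫ k f)
    (h' : pre a (κ f) = pre b (κ f)) : a = b :=
  (existsUnique_lift f (b ≫ k f) (pre b (κ f))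
    (by simpa using (κ_isNull f).pre b)).unique ⟨h, h'⟩ ⟨rfl, rfl⟩

/-- The map `s : Cf ⟶ Z` with `s.cf = z` and `s.γf = ζ`. -/
noncomputable def desc {X Y Z : C} (f : X ⟶ Y) (z : Y ⟶ Z) (ζ : Htpy X Z)
    (h : IsNullhomotopy ζ (f ≫ z)) : Cok f ⟶ Z :=
  (existsUnique_desc f z ζ h).choose

theorem c_desc {X Y Z : C} (f : X ⟶ Y) (z : Y ⟶ Z) (ζ : Htpy X Z)
    (h : IsNullhomotopy ζ (f ≫ z)) : c f ≫ desc f z ζ h = z :=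
  (existsUnique_desc f z ζ h).choose_spec.1.1

theorem post_γ_desc {X Y Z : C} (f : X ⟶ Y) (z : Y ⟶ Z) (ζ : Htpy X Z)
    (h : IsNullhomotopy ζ (f ≫ z)) : post (γ f) (desc f z ζ h) = ζ :=
  (existsUnique_desc f z ζ h).choose_spec.1.2

theorem Cok_hom_ext {X Y Z : C} {f : X ⟶ Y} {a b : Cok f ⟶ Z} (h : c f ≫ a = c f ≫ b)
    (h' : post (γ f) a = post (γ f) b) : a = b :=
  (existsUnique_desc f (c f ≫ b) (post (γ f) b)
    (by simpa using (γ_isNull f).post b)).unique ⟨h, h'⟩ ⟨rfl, rfl⟩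

/-- The loop object `ΩX = K(0 ⟶ X)`. -/
noncomputable abbrev loopObj (X : C) : C := K (fromZero X)

/-- The structural homotopy `ω : 0 ≃ 0 : ΩX ⟶ X`. -/
noncomputable def ω (X : C) : Htpy (loopObj X) X := κ (fromZero X)

theorem ω_isNull (X : C) : IsNullhomotopy (ω X) (zeroMap (loopObj X) X) := by
  have h := κ_isNull (fromZero X)
  rwa [map_to_zero (k (fromZero X))] at h

/-- The suspension `ΣX = C(X ⟶ 0)`. -/
noncomputable abbrev suspObj (X : C) : C := Cok (toZero X)

/-- The structural homotopy `σ : 0 ≃ 0 : X ⟶ ΣX`. -/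
noncomputable def σ (X : C) : Htpy X (suspObj X) := γ (toZero X)

theorem σ_isNull (X : C) : IsNullhomotopy (σ X) (zeroMap X (suspObj X)) := by
  have h := γ_isNull (toZero X)
  rwa [map_from_zero (c (toZero X))] at h

/-- The map `W ⟶ ΩX` corresponding to a homotopy `ξ : 0 ≃ 0 : W ⟶ X`. -/
noncomputable def loopLift {W X : C} (ξ : Htpy W X) (h : IsNullhomotopy ξ (zeroMap W X)) :
    W ⟶ loopObj X :=
  lift (fromZero X) (toZero W) ξ h

theorem pre_loopLift {W X : C} (ξ : Htpy W X) (h : IsNullhomotopy ξ (zeroMap W X)) :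
    pre (loopLift ξ h) (ω X) = ξ :=
  pre_lift_κ _ _ _ _

theorem loop_hom_ext {W X : C} {a b : W ⟶ loopObj X} (h : pre a (ω X) = pre b (ω X)) : a = b :=
  K_hom_ext (isZero_zeroObj.eq_of_tgt _ _) h

/-- The map `ΣX ⟶ Z` corresponding to a homotopy `ζ : 0 ≃ 0 : X ⟶ Z`. -/
noncomputable def suspDesc {X Z : C} (ζ : Htpy X Z) (h : IsNullhomotopy ζ (zeroMap X Z)) :
    suspObj X ⟶ Z :=
  desc (toZero X) (fromZero Z) ζ h

theorem post_suspDesc {X Z : C} (ζ : Htpy X Z) (h : IsNullhomotopy ζ (zeroMap X Z)) :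
    post (σ X) (suspDesc ζ h) = ζ :=
  post_γ_desc _ _ _ _

theorem susp_hom_ext {X Z : C} {a b : suspObj X ⟶ Z} (h : post (σ X) a = post (σ X) b) : a = b :=
  Cok_hom_ext (isZero_zeroObj.eq_of_src _ _) h

/-- `Ωf`, determined by `ω.Ωf = f.ω`. -/
noncomputable def loopMap {X Y : C} (f : X ⟶ Y) : loopObj X ⟶ loopObj Y :=
  loopLift (post (ω X) f) (by simpa [zeroMap_comp] using (ω_isNull X).post f)

theorem pre_loopMap {X Y : C} (f : X ⟶ Y) : pre (loopMap f) (ω Y) = post (ω X) f :=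
  pre_loopLift _ _

/-- `Σf`, determined by `Σf.σ = σ.f`. -/
noncomputable def suspMap {X Y : C} (f : X ⟶ Y) : suspObj X ⟶ suspObj Y :=
  suspDesc (pre f (σ Y)) (by simpa [comp_zeroMap] using (σ_isNull Y).pre f)

theorem post_suspMap {X Y : C} (f : X ⟶ Y) : post (σ X) (suspMap f) = pre f (σ Y) :=
  post_suspDesc _ _

variable (C) in
/-- The loop functor. -/
noncomputable def loop : C ⥤ C where
  obj := loopObj
  map := loopMap
  map_id X := loop_hom_ext (by rw [pre_loopMap, post_id, pre_id])
  map_comp f g := loop_hom_ext (by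
    rw [pre_loopMap, pre_comp, pre_loopMap, pre_post, pre_loopMap, post_comp])

variable (C) in
/-- The suspension functor. -/
noncomputable def susp : C ⥤ C where
  obj := suspObj
  map := suspMap
  map_id X := susp_hom_ext (by rw [post_suspMap, post_id, pre_id])
  map_comp f g := susp_hom_ext (by
    rw [post_suspMap, post_comp, post_suspMap, ← pre_post, post_suspMap, pre_comp])

/-- The unit `X ⟶ ΩΣX` of the adjunction `Σ ⊣ Ω`, determined by `ω.unit = σ`. -/
noncomputable def loopSuspUnit (X : C) : X ⟶ (loop C).obj ((susp C).obj X) :=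
  loopLift (σ X) (σ_isNull X)

/-- The counit `ΣΩX ⟶ X` of the adjunction `Σ ⊣ Ω`, determined by `counit.σ = ω`. -/
noncomputable def loopSuspCounit (X : C) : (susp C).obj ((loop C).obj X) ⟶ X :=
  suspDesc (ω X) (ω_isNull X)

variable (C) in
/-- An h-differential sequence `(f, g; α)`: consecutive maps with a nullhomotopy `α : 0 ≃ gf`. -/
structure HDiffSeq where
  X : C
  A : C
  Y : C
  f : X ⟶ A
  g : A ⟶ Y
  α : Htpy X Y
  isNull : IsNullhomotopy α (f ≫ g)

namespace HDiffSeq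

/-- `u_α : X ⟶ Kg`, determined by `kg.u_α = f` and `κg.u_α = α`. -/
noncomputable def uMap (S : HDiffSeq C) : S.X ⟶ K S.g := lift S.g S.f S.α S.isNull

/-- `v_α : Cf ⟶ Y`, determined by `v_α.cf = g` and `v_α.γf = α`. -/
noncomputable def vMap (S : HDiffSeq C) : Cok S.f ⟶ S.Y := desc S.f S.g S.α S.isNull

/-- The left homotopical homology `C(u_α)`. -/
noncomputable abbrev leftHomology (S : HDiffSeq C) : C := Cok S.uMap

/-- The right homotopical homology `K(v_α)`. -/
noncomputable abbrev rightHomology (S : HDiffSeq C) : C := K S.vMap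

/-- `i : C(u_α) ⟶ K(v_α)` is a comparison map: `kv_α.i.cu_α = cf.kg`, `kv_α.i.γu_α = γf` and
`κv_α.i.cu_α = κg`. -/
structure IsComparison (S : HDiffSeq C) (i : S.leftHomology ⟶ S.rightHomology) : Prop where
  comm : c S.uMap ≫ i ≫ k S.vMap = k S.g ≫ c S.f
  post_γ : post (post (γ S.uMap) i) (k S.vMap) = γ S.f
  pre_κ : pre (c S.uMap) (pre i (κ S.vMap)) = κ S.g

end HDiffSeq

end Defs

/-- A homology theory `H_n : C ⥤ D`, `0 ≤ n ≤ p`, on a pointed homotopical category `C`, with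
values in an abelian category `D`: homotopy invariant, exact on h-kernels in degree `0` and on
h-cokernels in degree `p`, and stable, with coherent natural isomorphisms
`H_n(ΩX) ≅ H_{n+1}(X)` and `H_n(X) ≅ H_{n+1}(ΣX)` for `0 ≤ n < p`. -/
structure HomologyTheory (C : Type u) [Category.{v} C] [PointedHomotopicalCategory.{w} C]
    (D : Type u') [Category.{v'} D] [Abelian D] (p : ℕ) where
  H : Fin (p + 1) → C ⥤ D
  homotopy_invariance : ∀ (n : Fin (p + 1)) {X Y : C} (α : Htpy X Y),
    (H n).map (dom α) = (H n).map (cod α)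
  exact_hker : ∀ {X Y : C} (f : X ⟶ Y),
    ∃ h : (H 0).map (k f) ≫ (H 0).map f = 0, (ShortComplex.mk _ _ h).Exact
  exact_hcok : ∀ {X Y : C} (f : X ⟶ Y),
    ∃ h : (H (Fin.last p)).map f ≫ (H (Fin.last p)).map (c f) = 0,
      (ShortComplex.mk _ _ h).Exact
  loopIso : ∀ n : Fin p, loop C ⋙ H n.castSucc ≅ H n.succ
  suspIso : ∀ n : Fin p, H n.castSucc ≅ susp C ⋙ H n.succ
  unit_coherence : ∀ (n : Fin p) (X : C),
    (H n.castSucc).map (loopSuspUnit X) ≫ (loopIso n).hom.app ((susp C).obj X) =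
      (suspIso n).hom.app X
  counit_coherence : ∀ (n : Fin p) (X : C),
    (suspIso n).hom.app ((loop C).obj X) ≫ (H n.succ).map (loopSuspCounit X) =
      (loopIso n).hom.app X

/-- A map is a weak equivalence, with respect to the theory, if it induces isomorphisms in all
degrees `0 ≤ n ≤ p`. -/
def HomologyTheory.WeakEquivalence {C : Type u} [Category.{v} C] [PointedHomotopicalCategory.{w} C]
    {D : Type u'} [Category.{v'} D] [Abelian D] {p : ℕ} (T : HomologyTheory C D p)
    {X Y : C} (f : X ⟶ Y) : Prop :=
  ∀ n : Fin (p + 1), IsIso ((T.H n).map f)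

end Homotopical

/-! After `H_n` is applied, the claim becomes a diagram chase in exact sequences. Stability carries
exactness on h-kernels from degree `0` upwards and exactness on h-cokernels from degree `p`
downwards. In every degree one then has the exact fibre sequence ΩX → ΩY → Kf → X → Y and cofibre
sequence X → Y → Cf → ΣX → ΣY, and also Ka → Kg → Kb for g = b·a and Cb → Cf → Ca for f = a·b.

Two half-isomorphisms carry the proof: X → K(cf) is epi on `H_n` (`epi_map_toKCok`), and C(kg) → Y
is mono on `H_n` (`mono_map_fromCokK`). They hold because Ω and Σ shift degrees compatibly with the
unit and counit; contractibility gives the end cases H_p(ΩX) = 0 and H_0(ΣX) = 0.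

Since g = v·cf, the sequence K(cf) → Kg → Kv is exact, and u is the composite X → K(cf) → Kg. So a
class of Kg dying in Kv comes from X and dies in Cu: this gives injectivity of i. Since f = kg·u,
the sequence Cu → Cf → C(kg) is exact, and v is the composite Cf → C(kg) → Y. So the image in Cf of
a class of Kv comes from Cu, and the remaining error comes from ΩY: this gives surjectivity. Only
the three equations for i enter, so every comparison map is covered. -/

namespace Homotopical

/-! ### Calculus of nullhomotopies up to 2-homotopy -/

section TwoHomotopies

variable {C : Type u} [Category.{v} C] [PointedHCategory.{w} C]

theorem post_zeroMap {X Y : C} (α : Htpy X Y) (Z : C) :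
    post α (zeroMap Y Z) = triv (zeroMap X Z) := by
  rw [zeroMap, post_comp, htpy_to_zero (post α (toZero Y)), post_triv]
  rfl

theorem pre_zeroMap {Y Z : C} (X : C) (α : Htpy Y Z) :
    pre (zeroMap X Y) α = triv (zeroMap X Z) := by
  rw [zeroMap, pre_comp, htpy_from_zero (pre (fromZero Y) α), pre_triv]
  rfl

theorem two_refl {X Y : C} (α : Htpy X Y) : Two α α := (two_equivalence X Y).refl α

theorem two_symm {X Y : C} {α β : Htpy X Y} (h : Two α β) : Two β α :=
  (two_equivalence X Y).symm h

theorem two_trans {X Y : C} {α β δ : Htpy X Y} (h : Two α β) (h' : Two β δ) : Two α δ :=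
  (two_equivalence X Y).trans h h'

theorem two_of_eq {X Y : C} {α β : Htpy X Y} (h : α = β) : Two α β := h ▸ two_refl α

theorem two_concat_of_left_eq_triv {X Y : C} {α β : Htpy X Y} (h : cod α = dom β) {f : X ⟶ Y}
    (hα : α = triv f) : Two (concat α β h) β := by
  subst hα
  obtain rfl : f = dom β := by rwa [cod_triv] at h
  exact triv_concat β

theorem two_concat_of_right_eq_triv {X Y : C} {α β : Htpy X Y} (h : cod α = dom β) {f : X ⟶ Y}
    (hβ : β = triv f) : Two (concat α β h) α := by
  subst hβ
  obtain rfl : f = cod α := by rw [h, dom_triv]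
  exact concat_triv α

/-- `(α - β) + β ≃₂ α`. -/
theorem two_concat_rev_cancel {X Y : C} {α β : Htpy X Y} (h : cod α = dom (rev β))
    (h' : cod (concat α (rev β) h) = dom β) :
    Two (concat (concat α (rev β) h) β h') α := by
  refine two_trans (concat_assoc α (rev β) β h (cod_rev β)) ?_
  have hc : cod α = cod β := by rw [h, dom_rev]
  refine two_trans (two_concat _ (by rw [dom_triv, hc]) (two_refl α) (rev_concat β)) ?_
  exact two_concat_of_right_eq_triv _ rfl

/-- Interchange for two nullhomotopies. -/
theorem IsNullhomotopy.interchange {X Y Z : C} {α : Htpy X Y} {β : Htpy Y Z} {f : X ⟶ Y}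
    {g : Y ⟶ Z} (hα : IsNullhomotopy α f) (hβ : IsNullhomotopy β g) :
    Two (HCategory.pre f β) (HCategory.post α g) := by
  obtain ⟨hα, rfl⟩ := hα
  obtain ⟨hβ, rfl⟩ := hβ
  refine two_trans (two_symm ?_) (two_trans (HCategory.interchange α β) ?_)
  · exact two_concat_of_left_eq_triv _ (by rw [hβ, post_zeroMap])
  · exact two_concat_of_left_eq_triv _ (by rw [hα, pre_zeroMap])

/-- The difference `α - β : 0 ≃ 0` of two nullhomotopies of the same map. -/
theorem IsNullhomotopy.concat_rev {X Y : C} {α β : Htpy X Y} {f : X ⟶ Y}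
    (hα : IsNullhomotopy α f) (hβ : IsNullhomotopy β f) (h : cod α = dom (rev β)) :
    IsNullhomotopy (concat α (rev β) h) (zeroMap X Y) :=
  ⟨by rw [dom_concat, hα.1], by rw [cod_concat, cod_rev, hβ.1]⟩

end TwoHomotopies

/-! ### Universal properties up to homotopy; maps of the fibre and cofibre sequences -/

section Kernels

variable {C : Type u} [Category.{v} C] [PointedHomotopicalCategory.{w} C]

theorem exists_lift₂ {X Y W : C} {f : X ⟶ Y} (a b : W ⟶ K f) (φ : Htpy W X)
    (ha : dom φ = a ≫ k f) (hb : cod φ = b ≫ k f) (h : cod (pre a (κ f)) = dom (post φ f))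
    (H : Two (concat (pre a (κ f)) (post φ f) h) (pre b (κ f))) :
    ∃ ψ : Htpy W (K f), dom ψ = a ∧ cod ψ = b ∧ post ψ (k f) = φ :=
  (PointedHomotopicalCategory.hker f).exists_lift₂ a b φ ha hb H

theorem exists_desc₂ {X Y Z : C} {f : X ⟶ Y} (a b : Cok f ⟶ Z) (φ : Htpy Y Z)
    (ha : dom φ = c f ≫ a) (hb : cod φ = c f ≫ b) (h : cod (post (γ f) a) = dom (pre f φ))
    (H : Two (concat (post (γ f) a) (pre f φ) h) (post (γ f) b)) :
    ∃ ψ : Htpy (Cok f) Z, dom ψ = a ∧ cod ψ = b ∧ pre (c f) ψ = φ :=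
  (PointedHomotopicalCategory.hcok f).exists_desc₂ a b φ ha hb H

/-- The 2-dimensional property, applied to a trivial homotopy: equality of the structural homotopies
forces equality of maps, while 2-homotopy still forces a homotopy. -/
theorem exists_htpy_of_two_lift {X Y W : C} {f : X ⟶ Y} {a b : W ⟶ K f}
    (h : a ≫ k f = b ≫ k f) (H : Two (pre a (κ f)) (pre b (κ f))) :
    ∃ ψ : Htpy W (K f), dom ψ = a ∧ cod ψ = b := by
  obtain ⟨ψ, h₁, h₂, -⟩ := exists_lift₂ a b (triv (a ≫ k f)) (dom_triv _)
    ((cod_triv _).trans h)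
    (by rw [cod_pre, (κ_isNull f).2, dom_post, dom_triv, Category.assoc])
    (two_trans (two_concat_of_right_eq_triv _ (post_triv _ _)) H)
  exact ⟨ψ, h₁, h₂⟩

theorem exists_htpy_of_two_desc {X Y Z : C} {f : X ⟶ Y} {a b : Cok f ⟶ Z}
    (h : c f ≫ a = c f ≫ b) (H : Two (post (γ f) a) (post (γ f) b)) :
    ∃ ψ : Htpy (Cok f) Z, dom ψ = a ∧ cod ψ = b := by
  obtain ⟨ψ, h₁, h₂, -⟩ := exists_desc₂ a b (triv (c f ≫ a)) (dom_triv _)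
    ((cod_triv _).trans h)
    (by rw [cod_post, (γ_isNull f).2, dom_pre, dom_triv, Category.assoc])
    (two_trans (two_concat_of_right_eq_triv _ (pre_triv _ _)) H)
  exact ⟨ψ, h₁, h₂⟩

/-- A nullhomotopy of `b ≫ k f` which is coherent with `κ f` lifts to a nullhomotopy of `b`. -/
theorem exists_nullhomotopy_lift {X Y W : C} {f : X ⟶ Y} (b : W ⟶ K f) (φ : Htpy W X)
    (hφ : IsNullhomotopy φ (b ≫ k f)) (H : Two (post φ f) (pre b (κ f))) :
    ∃ ψ : Htpy W (K f), IsNullhomotopy ψ b ∧ post ψ (k f) = φ := by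
  obtain ⟨ψ, h₁, h₂, h₃⟩ := exists_lift₂ (zeroMap W (K f)) b φ
    (by rw [hφ.1, zeroMap_comp]) hφ.2
    (by rw [pre_zeroMap, cod_triv, dom_post, hφ.1, zeroMap_comp])
    (two_trans (two_concat_of_left_eq_triv _ (pre_zeroMap _ _)) H)
  exact ⟨ψ, ⟨h₁, h₂⟩, h₃⟩

/-- A nullhomotopy of `c f ≫ b` which is coherent with `γ f` extends to a nullhomotopy of `b`. -/
theorem exists_nullhomotopy_desc {X Y Z : C} {f : X ⟶ Y} (b : Cok f ⟶ Z) (φ : Htpy Y Z)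
    (hφ : IsNullhomotopy φ (c f ≫ b)) (H : Two (pre f φ) (post (γ f) b)) :
    ∃ ψ : Htpy (Cok f) Z, IsNullhomotopy ψ b ∧ pre (c f) ψ = φ := by
  obtain ⟨ψ, h₁, h₂, h₃⟩ := exists_desc₂ (zeroMap (Cok f) Z) b φ
    (by rw [hφ.1, comp_zeroMap]) hφ.2
    (by rw [post_zeroMap, cod_triv, dom_pre, hφ.1, comp_zeroMap])
    (two_trans (two_concat_of_left_eq_triv _ (post_zeroMap _ _)) H)
  exact ⟨ψ, ⟨h₁, h₂⟩, h₃⟩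

theorem loopMap_zeroMap (X Y : C) : loopMap (zeroMap X Y) = zeroMap _ _ :=
  loop_hom_ext (by rw [pre_loopMap, post_zeroMap, pre_zeroMap])

/-- The map `ΩY ⟶ Kf` of the fibre sequence of `f`. -/
noncomputable def loopToK {X Y : C} (f : X ⟶ Y) : loopObj Y ⟶ K f :=
  lift f (zeroMap _ X) (ω Y) (by rw [zeroMap_comp]; exact ω_isNull Y)

theorem loopToK_k {X Y : C} (f : X ⟶ Y) : loopToK f ≫ k f = zeroMap _ X := lift_k _ _ _ _

theorem pre_loopToK {X Y : C} (f : X ⟶ Y) : pre (loopToK f) (κ f) = ω Y := pre_lift_κ _ _ _ _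

/-- The map `Cf ⟶ ΣX` of the cofibre sequence of `f`. -/
noncomputable def cokToSusp {X Y : C} (f : X ⟶ Y) : Cok f ⟶ suspObj X :=
  desc f (zeroMap Y _) (σ X) (by rw [comp_zeroMap]; exact σ_isNull X)

theorem c_cokToSusp {X Y : C} (f : X ⟶ Y) : c f ≫ cokToSusp f = zeroMap Y _ := c_desc _ _ _ _

theorem post_cokToSusp {X Y : C} (f : X ⟶ Y) : post (γ f) (cokToSusp f) = σ X :=
  post_γ_desc _ _ _ _

/-- The comparison `X ⟶ K(cf)`. -/
noncomputable def toKCok {X Y : C} (f : X ⟶ Y) : X ⟶ K (c f) := lift (c f) f (γ f) (γ_isNull f)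

theorem toKCok_k {X Y : C} (f : X ⟶ Y) : toKCok f ≫ k (c f) = f := lift_k _ _ _ _

theorem pre_toKCok {X Y : C} (f : X ⟶ Y) : pre (toKCok f) (κ (c f)) = γ f := pre_lift_κ _ _ _ _

/-- The comparison `C(kf) ⟶ Y`. -/
noncomputable def fromCokK {X Y : C} (f : X ⟶ Y) : Cok (k f) ⟶ Y := desc (k f) f (κ f) (κ_isNull f)

theorem c_fromCokK {X Y : C} (f : X ⟶ Y) : c (k f) ≫ fromCokK f = f := c_desc _ _ _ _

theorem post_fromCokK {X Y : C} (f : X ⟶ Y) : post (γ (k f)) (fromCokK f) = κ f :=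
  post_γ_desc _ _ _ _

/-- The unit of `Σ ⊣ Ω`, with its codomain written as an object. -/
noncomputable def toLoopSusp (X : C) : X ⟶ loopObj (suspObj X) := loopSuspUnit X

/-- The counit of `Σ ⊣ Ω`, with its domain written as an object. -/
noncomputable def fromSuspLoop (X : C) : suspObj (loopObj X) ⟶ X := loopSuspCounit X

/-- The map `K(cf) ⟶ ΩΣX`. -/
noncomputable def kCokToLoopSusp {X Y : C} (f : X ⟶ Y) : K (c f) ⟶ loopObj (suspObj X) :=
  loopLift (post (κ (c f)) (cokToSusp f)) (by
    have h := (κ_isNull (c f)).post (cokToSusp f)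
    rwa [Category.assoc, c_cokToSusp, comp_zeroMap] at h)

/-- Together with the next identity, this compares classes of K(cf) coming from X with those coming
from ΩCf: both are measured in ΩΣX, where the unit coherence applies. -/
theorem toKCok_kCokToLoopSusp {X Y : C} (f : X ⟶ Y) :
    toKCok f ≫ kCokToLoopSusp f = toLoopSusp X :=
  loop_hom_ext (by
    rw [pre_comp, kCokToLoopSusp, pre_loopLift, pre_post, pre_toKCok, post_cokToSusp]
    exact (pre_loopLift _ (σ_isNull X)).symm)

theorem loopToK_kCokToLoopSusp {X Y : C} (f : X ⟶ Y) :
    loopToK (c f) ≫ kCokToLoopSusp f = loopMap (cokToSusp f) :=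
  loop_hom_ext (by
    rw [pre_comp, kCokToLoopSusp, pre_loopLift, pre_post, pre_loopToK, pre_loopMap])

/-- The map `ΣΩY ⟶ C(kf)`. -/
noncomputable def suspLoopToCokK {X Y : C} (f : X ⟶ Y) : suspObj (loopObj Y) ⟶ Cok (k f) :=
  suspDesc (pre (loopToK f) (γ (k f))) (by
    have h := (γ_isNull (k f)).pre (loopToK f)
    rwa [← Category.assoc, loopToK_k, zeroMap_comp] at h)

/-- The counterpart for C(kf), through which the counit coherence enters. -/
theorem suspLoopToCokK_fromCokK {X Y : C} (f : X ⟶ Y) :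
    suspLoopToCokK f ≫ fromCokK f = fromSuspLoop Y :=
  susp_hom_ext (by
    rw [post_comp, suspLoopToCokK, post_suspDesc, ← pre_post, post_fromCokK, pre_loopToK]
    exact (post_suspDesc _ (ω_isNull Y)).symm)

theorem suspLoopToCokK_cokToSusp {X Y : C} (f : X ⟶ Y) :
    suspLoopToCokK f ≫ cokToSusp (k f) = suspMap (loopToK f) :=
  susp_hom_ext (by
    rw [post_comp, suspLoopToCokK, post_suspDesc, ← pre_post, post_cokToSusp, post_suspMap])

end Kernels

/-! ### Exactness of fibre and cofibre sequences under a homotopy invariant functor -/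

section Exactness

variable {C : Type u} [Category.{v} C] {D : Type u'} [Category.{v'} D] [Abelian D]

/-- The functor `F` takes `A ⟶ B ⟶ Z` to an exact sequence. -/
def ExactAt (F : C ⥤ D) {A B Z : C} (f : A ⟶ B) (g : B ⟶ Z) : Prop :=
  ∃ h : F.map f ≫ F.map g = 0, (ShortComplex.mk _ _ h).Exact

namespace ExactAt

variable {F G : C ⥤ D} {A B Z : C} {f : A ⟶ B} {g : B ⟶ Z}

theorem lift (h : ExactAt F f g) {T : D} (x : T ⟶ F.obj B) (hx : x ≫ F.map g = 0) :
    ∃ (T' : D) (π : T' ⟶ T) (_ : Epi π) (y : T' ⟶ F.obj A), π ≫ x = y ≫ F.map f :=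
  h.choose_spec.exact_up_to_refinements x hx

/-- The image of `F.map f` lies in that of `F.map f'`, which is enough once the composite vanishes.
Exactness at any h-kernel thus passes to every null composite through which that h-kernel factors up
to `F`. -/
theorem of_factor (h : ExactAt F f g) {A' : C} (f' : A' ⟶ B) (h' : F.map f' ≫ F.map g = 0)
    (t : A ⟶ A') (ht : F.map (t ≫ f') = F.map f) : ExactAt F f' g := by
  refine ⟨h', ?_⟩
  rw [ShortComplex.exact_iff_exact_up_to_refinements]
  intro T x hx
  obtain ⟨T', π, hπ, y, hy⟩ := h.lift x hx
  exact ⟨T', π, hπ, y ≫ F.map t, by rw [Category.assoc, ← F.map_comp, ht]; exact hy⟩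

theorem of_cofactor (h : ExactAt F f g) {Z' : C} (g' : B ⟶ Z') (h' : F.map f ≫ F.map g' = 0)
    (t : Z' ⟶ Z) (ht : F.map (g' ≫ t) = F.map g) : ExactAt F f g' := by
  refine ⟨h', ?_⟩
  rw [ShortComplex.exact_iff_exact_up_to_refinements]
  intro T x hx
  exact h.lift x (by
    have hx' : x ≫ F.map g' = 0 := hx
    rw [← ht, F.map_comp, reassoc_of% hx', Limits.zero_comp])

theorem of_iso (h : ExactAt F f g) (e : F ≅ G) : ExactAt G f g := by
  obtain ⟨h₀, h⟩ := h
  have h₁ : G.map f ≫ G.map g = 0 := by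
    rw [← cancel_epi (e.hom.app A), ← e.hom.naturality_assoc, ← e.hom.naturality,
      reassoc_of% h₀, Limits.zero_comp, Limits.comp_zero]
  refine ⟨h₁, (ShortComplex.exact_iff_of_iso ?_).1 h⟩
  exact ShortComplex.isoMk (e.app A) (e.app B) (e.app Z) (by simp) (by simp)

end ExactAt

variable [PointedHomotopicalCategory.{w} C]

/-- Homotopy invariant functors which preserve zero maps. -/
structure HInvariant (F : C ⥤ D) : Prop where
  map_eq : ∀ {X Y : C} (α : Htpy X Y), F.map (dom α) = F.map (cod α)
  map_zero : ∀ X Y : C, F.map (zeroMap X Y) = 0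

variable {F : C ⥤ D}

theorem HInvariant.map_null (hF : HInvariant F) {X Y : C} {α : Htpy X Y} {f : X ⟶ Y}
    (h : IsNullhomotopy α f) : F.map f = 0 := by
  rw [← h.2, ← hF.map_eq, h.1, hF.map_zero]

theorem HInvariant.map_k_comp (hF : HInvariant F) {X Y : C} (f : X ⟶ Y) :
    F.map (k f) ≫ F.map f = 0 := by
  rw [← F.map_comp]; exact hF.map_null (κ_isNull f)

theorem HInvariant.map_comp_c (hF : HInvariant F) {X Y : C} (f : X ⟶ Y) :
    F.map f ≫ F.map (c f) = 0 := by
  rw [← F.map_comp]; exact hF.map_null (γ_isNull f)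

theorem HInvariant.of_iso (hF : HInvariant F) {G : C ⥤ D} (e : F ≅ G) : HInvariant G where
  map_eq α := by
    rw [← cancel_epi (e.hom.app _), ← e.hom.naturality, ← e.hom.naturality, hF.map_eq]
  map_zero X Y := by
    rw [← cancel_epi (e.hom.app _), ← e.hom.naturality, hF.map_zero, Limits.zero_comp,
      Limits.comp_zero]

theorem HInvariant.isZero_of_contractible (hF : HInvariant F) {X : C} (hX : Contractible X) :
    Limits.IsZero (F.obj X) := by
  obtain ⟨α, h₁, h₂⟩ := hX
  rw [Limits.IsZero.iff_id_eq_zero, ← F.map_id, ← h₁, hF.map_eq, h₂, hF.map_zero]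

/-- The fibre sequence is exact at `Kf`. -/
theorem exactAt_loopToK_k (hF : HInvariant F)
    (hk : ∀ {X Y : C} (f : X ⟶ Y), ExactAt F (k f) f) {X Y : C} (f : X ⟶ Y) :
    ExactAt F (loopToK f) (k f) := by
  have h₁ : IsNullhomotopy (pre (k (k f)) (κ f)) ((k (k f) ≫ k f) ≫ f) := by
    rw [Category.assoc]; exact (κ_isNull f).pre _
  have h₂ := (κ_isNull (k f)).post f
  have h : cod (pre (k (k f)) (κ f)) = dom (rev (post (κ (k f)) f)) := by
    rw [dom_rev, h₁.2, h₂.2]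
  -- The map K(kf) → ΩY classifies the difference of the two nullhomotopies κf·k(kf) and f·κ(kf) of
  -- one map. Through it, k(kf) factors up to homotopy.
  refine (hk (k f)).of_factor (loopToK f) ?_ (loopLift (concat _ _ h) (h₁.concat_rev h₂ h)) ?_
  · rw [← F.map_comp, loopToK_k, hF.map_zero]
  · have e : (loopLift (concat _ _ h) (h₁.concat_rev h₂ h) ≫ loopToK f) ≫ k f =
        zeroMap _ _ := by
      rw [Category.assoc, loopToK_k, comp_zeroMap]
    have e' : pre (loopLift (concat _ _ h) (h₁.concat_rev h₂ h) ≫ loopToK f) (κ f) =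
        concat _ _ h := by
      rw [pre_comp, pre_loopToK, pre_loopLift]
    obtain ⟨ψ, hψ₁, hψ₂, -⟩ := exists_lift₂ (loopLift (concat _ _ h) (h₁.concat_rev h₂ h) ≫
      loopToK f) (k (k f)) (κ (k f)) (by rw [e, (κ_isNull (k f)).1]) (κ_isNull (k f)).2
      (by rw [e', cod_concat, cod_rev])
      (by simp only [e']; exact two_concat_rev_cancel h _)
    rw [← hψ₁, hF.map_eq, hψ₂]

/-- The cofibre sequence is exact at `Cf`. -/
theorem exactAt_c_cokToSusp (hF : HInvariant F)
    (hc : ∀ {X Y : C} (f : X ⟶ Y), ExactAt F f (c f)) {X Y : C} (f : X ⟶ Y) :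
    ExactAt F (c f) (cokToSusp f) := by
  have h₁ : IsNullhomotopy (post (γ f) (c (c f))) (f ≫ c f ≫ c (c f)) := by
    rw [← Category.assoc]; exact (γ_isNull f).post _
  have h₂ := (γ_isNull (c f)).pre f
  have h : cod (post (γ f) (c (c f))) = dom (rev (pre f (γ (c f)))) := by
    rw [dom_rev, h₁.2, h₂.2]
  refine (hc (c f)).of_cofactor (cokToSusp f) ?_ (suspDesc (concat _ _ h) (h₁.concat_rev h₂ h)) ?_
  · rw [← F.map_comp, c_cokToSusp, hF.map_zero]
  · have e : c f ≫ cokToSusp f ≫ suspDesc (concat _ _ h) (h₁.concat_rev h₂ h) =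
        zeroMap _ _ := by
      rw [← Category.assoc, c_cokToSusp, zeroMap_comp]
    have e' : post (γ f) (cokToSusp f ≫ suspDesc (concat _ _ h) (h₁.concat_rev h₂ h)) =
        concat _ _ h := by
      rw [post_comp, post_cokToSusp, post_suspDesc]
    obtain ⟨ψ, hψ₁, hψ₂, -⟩ := exists_desc₂ (cokToSusp f ≫
      suspDesc (concat _ _ h) (h₁.concat_rev h₂ h)) (c (c f)) (γ (c f))
      (by rw [e, (γ_isNull (c f)).1]) (γ_isNull (c f)).2
      (by rw [e', cod_concat, cod_rev])
      (by simp only [e']; exact two_concat_rev_cancel h _)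
    rw [← hψ₁, hF.map_eq, hψ₂]

/-- For a composite `g = a ≫ v`, the sequence `Ka ⟶ Kg ⟶ Kv` is exact. -/
theorem exactAt_K_comp (hF : HInvariant F)
    (hk : ∀ {X Y : C} (f : X ⟶ Y), ExactAt F (k f) f) {A B Y : C} {a : A ⟶ B} {b : B ⟶ Y}
    {g : A ⟶ Y} {s : K a ⟶ K g} {m : K g ⟶ K b} (hs : s ≫ k g = k a)
    (hs' : pre s (κ g) = post (κ a) b) (hm : m ≫ k b = k g ≫ a) (hm' : pre m (κ b) = κ g) :
    ExactAt F s m := by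
  have hn : IsNullhomotopy (post (κ m) (k b)) ((k m ≫ k g) ≫ a) := by
    rw [Category.assoc, ← hm, ← Category.assoc]; exact (κ_isNull m).post _
  -- On Km, pushing `κ m` forward along `k b` gives a nullhomotopy of a·kg·km, hence a map Km → Ka.
  -- Interchange of `κ m` and `κ b` shows that followed by `s` it is homotopic to `k m`.
  refine (hk m).of_factor s ?_ (lift a (k m ≫ k g) (post (κ m) (k b)) hn) ?_
  · obtain ⟨ψ, hψ, -⟩ := exists_nullhomotopy_lift (s ≫ m) (κ a)
      (by rw [Category.assoc, hm, reassoc_of% hs]; exact κ_isNull a)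
      (two_of_eq (by rw [pre_comp, hm', hs']))
    rw [← F.map_comp, hF.map_null hψ]
  · obtain ⟨ψ, h₁, h₂⟩ := exists_htpy_of_two_lift
      (a := lift a (k m ≫ k g) (post (κ m) (k b)) hn ≫ s) (b := k m)
      (by rw [Category.assoc, hs, lift_k]) (by
        rw [pre_comp, hs', pre_post, pre_lift_κ, ← post_comp, ← hm', ← pre_comp]
        exact two_symm ((κ_isNull m).interchange (κ_isNull b)))
    rw [← h₁, hF.map_eq, h₂]

/-- For a composite `f = b ≫ a`, the sequence `Cb ⟶ Cf ⟶ Ca` is exact. -/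
theorem exactAt_Cok_comp (hF : HInvariant F)
    (hc : ∀ {X Y : C} (f : X ⟶ Y), ExactAt F f (c f)) {A B X : C} {a : B ⟶ A} {b : X ⟶ B}
    {f : X ⟶ A} {s : Cok f ⟶ Cok a} {m : Cok b ⟶ Cok f} (hs : c f ≫ s = c a)
    (hs' : post (γ f) s = pre b (γ a)) (hm : c b ≫ m = a ≫ c f) (hm' : post (γ b) m = γ f) :
    ExactAt F m s := by
  have hn : IsNullhomotopy (pre (c b) (γ m)) (a ≫ c f ≫ c m) := by
    rw [← Category.assoc, ← hm, Category.assoc]; exact (γ_isNull m).pre _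
  refine (hc m).of_cofactor s ?_ (desc a (c f ≫ c m) (pre (c b) (γ m)) hn) ?_
  · obtain ⟨ψ, hψ, -⟩ := exists_nullhomotopy_desc (m ≫ s) (γ a)
      (by rw [reassoc_of% hm, hs]; exact γ_isNull a)
      (two_of_eq (by rw [post_comp, hm', hs']))
    rw [← F.map_comp, hF.map_null hψ]
  · obtain ⟨ψ, h₁, h₂⟩ := exists_htpy_of_two_desc
      (a := s ≫ desc a (c f ≫ c m) (pre (c b) (γ m)) hn) (b := c m)
      (by rw [reassoc_of% hs, c_desc]) (by
        rw [post_comp, hs', ← pre_post, post_γ_desc, ← pre_comp, ← hm', ← post_comp]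
        exact (γ_isNull b).interchange (γ_isNull m))
    rw [← h₁, hF.map_eq, h₂]

/-- The composite 0 → X → Y has h-kernels ΩX, ΩY and Kf. -/
theorem exactAt_loopMap_loopToK (hF : HInvariant F)
    (hk : ∀ {X Y : C} (f : X ⟶ Y), ExactAt F (k f) f) {X Y : C} (f : X ⟶ Y) :
    ExactAt F (loopMap f) (loopToK f) :=
  exactAt_K_comp hF hk (a := fromZero X) (b := f) (g := fromZero Y)
    (isZero_zeroObj.eq_of_tgt _ _) (pre_loopMap f)
    (by rw [loopToK_k, map_to_zero (k (fromZero Y))]; rfl) (pre_loopToK f)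

theorem exactAt_cokToSusp_suspMap (hF : HInvariant F)
    (hc : ∀ {X Y : C} (f : X ⟶ Y), ExactAt F f (c f)) {X Y : C} (f : X ⟶ Y) :
    ExactAt F (cokToSusp f) (suspMap f) :=
  exactAt_Cok_comp hF hc (a := toZero Y) (b := f) (f := toZero X)
    (isZero_zeroObj.eq_of_src _ _) (post_suspMap f)
    (by rw [c_cokToSusp, map_from_zero (c (toZero X))]; rfl) (post_cokToSusp f)

/-- It suffices to factor k(Ωf) through Ω(kf). A map into ΩX is a self-homotopy of zero; interchange
of κ(Ωf) with ω makes its image in Y 2-homotopic to the trivial one, so it lifts to a self-homotopy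
of zero into Kf. -/
theorem exactAt_loopMap_k (hΩ : HInvariant (loop C ⋙ F))
    (hk : ∀ {X Y : C} (f : X ⟶ Y), ExactAt F (k f) f) {X Y : C} (f : X ⟶ Y) :
    ExactAt (loop C ⋙ F) (k f) f := by
  have hn : IsNullhomotopy (pre (k (loopMap f)) (ω X)) (zeroMap _ _ ≫ k f) := by
    rw [zeroMap_comp]; simpa [comp_zeroMap] using (ω_isNull X).pre (k (loopMap f))
  obtain ⟨τ, hτ, hτ'⟩ := exists_nullhomotopy_lift (f := f) _ _ hn (by
    rw [pre_zeroMap, ← pre_post, ← pre_loopMap, ← pre_comp]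
    refine two_trans ((κ_isNull (loopMap f)).interchange (ω_isNull Y)) (two_of_eq ?_)
    rw [post_zeroMap])
  obtain ⟨h₀, h⟩ := (hk (loopMap f)).of_factor (loopMap (k f)) (hΩ.map_k_comp f) (loopLift τ hτ)
    (congrArg F.map (loop_hom_ext (by
      rw [pre_comp, pre_loopMap, pre_post, pre_loopLift, hτ'])))
  exact ⟨h₀, h⟩

theorem exactAt_suspMap_c (hS : HInvariant (susp C ⋙ F))
    (hc : ∀ {X Y : C} (f : X ⟶ Y), ExactAt F f (c f)) {X Y : C} (f : X ⟶ Y) :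
    ExactAt (susp C ⋙ F) f (c f) := by
  have hn : IsNullhomotopy (post (σ Y) (c (suspMap f))) (c f ≫ zeroMap _ _) := by
    rw [comp_zeroMap]; simpa [zeroMap_comp] using (σ_isNull Y).post (c (suspMap f))
  obtain ⟨τ, hτ, hτ'⟩ := exists_nullhomotopy_desc (f := f) _ _ hn (by
    rw [post_zeroMap, pre_post, ← post_suspMap, ← post_comp]
    refine two_trans (two_symm ((σ_isNull X).interchange (γ_isNull (suspMap f))))
      (two_of_eq ?_)
    rw [pre_zeroMap])
  obtain ⟨h₀, h⟩ := (hc (suspMap f)).of_cofactor (suspMap (c f)) (hS.map_comp_c f)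
    (suspDesc τ hτ)
    (congrArg F.map (susp_hom_ext (by
      rw [post_comp, post_suspMap, ← pre_post, post_suspDesc, hτ'])))
  exact ⟨h₀, h⟩

end Exactness

/-! ### Homology in all degrees: exactness, vanishing and the two half-isomorphisms -/

namespace HomologyTheory

variable {C : Type u} [Category.{v} C] [PointedHomotopicalCategory.{w} C]
  {D : Type u'} [Category.{v'} D] [Abelian D] {p : ℕ} (T : HomologyTheory C D p)

/-- In degree `0`, every zero map factors through `k (𝟙 0) ≫ 𝟙 0`, which is killed by exactness on
h-kernels. Looping raises the degree. -/
theorem hInvariant (n : Fin (p + 1)) : HInvariant (T.H n) := by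
  induction n using Fin.induction with
  | zero =>
    refine ⟨T.homotopy_invariance 0, fun X Y => ?_⟩
    obtain ⟨h, -⟩ := T.exact_hker (𝟙 (zeroObj (C := C)))
    have h' : zeroMap X Y = toZero X ≫ fromZero _ ≫ (k (𝟙 (zeroObj (C := C))) ≫ 𝟙 _) ≫
        fromZero Y := by
      rw [zeroMap, ← fromZero_comp (fromZero Y), map_from_zero (𝟙 _ : zeroObj (C := C) ⟶ _)]
      simp only [fromZero_comp]
    rw [h', (T.H 0).map_comp, (T.H 0).map_comp, (T.H 0).map_comp, (T.H 0).map_comp, h]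
    simp
  | succ n ih =>
    refine ⟨T.homotopy_invariance _, fun X Y => ?_⟩
    rw [← cancel_epi ((T.loopIso n).hom.app X), ← (T.loopIso n).hom.naturality]
    have : (loop C ⋙ T.H n.castSucc).map (zeroMap X Y) = 0 :=
      (congrArg (T.H n.castSucc).map (loopMap_zeroMap X Y)).trans (ih.map_zero _ _)
    rw [this, Limits.zero_comp, Limits.comp_zero]

theorem exactAt_k (n : Fin (p + 1)) : ∀ {X Y : C} (f : X ⟶ Y), ExactAt (T.H n) (k f) f := by
  induction n using Fin.induction with
  | zero => exact T.exact_hker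
  | succ n ih =>
    intro X Y f
    exact (exactAt_loopMap_k ((T.hInvariant _).of_iso (T.loopIso n).symm) ih f).of_iso
      (T.loopIso n)

/-- Exactness on h-cokernels is given only in degree `p`, so suspension propagates it by descending
induction. -/
theorem exactAt_c (n : Fin (p + 1)) : ∀ {X Y : C} (f : X ⟶ Y), ExactAt (T.H n) f (c f) := by
  induction n using Fin.reverseInduction with
  | last => exact T.exact_hcok
  | cast n ih =>
    intro X Y f
    exact (exactAt_suspMap_c ((T.hInvariant _).of_iso (T.suspIso n)) ih f).of_iso
      (T.suspIso n).symm

theorem isZero_of_loop_iterate (n : Fin (p + 1)) :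
    ∀ X : C, Limits.IsZero ((T.H 0).obj ((loop C).obj^[n] X)) →
      Limits.IsZero ((T.H n).obj X) := by
  induction n using Fin.induction with
  | zero => exact fun _ h => h
  | succ n ih =>
    exact fun X h => (ih ((loop C).obj X) h).of_iso ((T.loopIso n).app X).symm

theorem isZero_of_susp_iterate (n : Fin (p + 1)) :
    ∀ X : C, Limits.IsZero ((T.H (Fin.last p)).obj ((susp C).obj^[p - n] X)) →
      Limits.IsZero ((T.H n).obj X) := by
  induction n using Fin.reverseInduction with
  | last => intro X h; simpa using h
  | cast n ih =>
    intro X h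
    have e : p - (n.castSucc : ℕ) = (p - (n.succ : ℕ)) + 1 := by
      simp only [Fin.val_castSucc, Fin.val_succ]; omega
    rw [e] at h
    exact (ih ((susp C).obj X) h).of_iso ((T.suspIso n).app X)

/-- H_p(ΩX) is H_0 of the `p`-fold loop object of ΩX, that is, of Ω^{p+1}X. -/
theorem isZero_loop (hloop : ∀ X : C, Contractible ((loop C).obj^[p + 1] X)) (X : C) :
    Limits.IsZero ((T.H (Fin.last p)).obj (loopObj X)) :=
  T.isZero_of_loop_iterate (Fin.last p) _
    ((T.hInvariant 0).isZero_of_contractible (hloop X))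

theorem isZero_susp (hsusp : ∀ X : C, Contractible ((susp C).obj^[p + 1] X)) (X : C) :
    Limits.IsZero ((T.H 0).obj (suspObj X)) :=
  T.isZero_of_susp_iterate 0 _ ((T.hInvariant _).isZero_of_contractible (hsusp X))

/-- The isomorphism `H_n(ΩX) ≅ H_{n+1}(X)`. -/
noncomputable def loopObjIso (n : Fin p) (X : C) :
    (T.H n.castSucc).obj (loopObj X) ≅ (T.H n.succ).obj X :=
  (T.loopIso n).app X

/-- The isomorphism `H_n(X) ≅ H_{n+1}(ΣX)`. -/
noncomputable def suspObjIso (n : Fin p) (X : C) :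
    (T.H n.castSucc).obj X ≅ (T.H n.succ).obj (suspObj X) :=
  (T.suspIso n).app X

theorem map_loopMap_loopObjIso (n : Fin p) {X Y : C} (f : X ⟶ Y) :
    (T.H n.castSucc).map (loopMap f) ≫ (T.loopObjIso n Y).hom =
      (T.loopObjIso n X).hom ≫ (T.H n.succ).map f :=
  (T.loopIso n).hom.naturality f

theorem map_suspObjIso (n : Fin p) {X Y : C} (f : X ⟶ Y) :
    (T.H n.castSucc).map f ≫ (T.suspObjIso n Y).hom =
      (T.suspObjIso n X).hom ≫ (T.H n.succ).map (suspMap f) :=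
  (T.suspIso n).hom.naturality f

theorem map_toLoopSusp (n : Fin p) (X : C) :
    (T.H n.castSucc).map (toLoopSusp X) ≫ (T.loopObjIso n (suspObj X)).hom =
      (T.suspObjIso n X).hom :=
  T.unit_coherence n X

theorem map_fromSuspLoop (n : Fin p) (X : C) :
    (T.suspObjIso n (loopObj X)).hom ≫ (T.H n.succ).map (fromSuspLoop X) =
      (T.loopObjIso n X).hom :=
  T.counit_coherence n X

/-- Below the top degree, `X ⟶ K(cf)` induces an epimorphism. -/
theorem epi_map_toKCok_castSucc (n : Fin p) {X A : C} (f : X ⟶ A) :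
    Epi ((T.H n.castSucc).map (toKCok f)) := by
  have hF := T.hInvariant n.castSucc
  have hG := T.hInvariant n.succ
  rw [epi_iff_surjective_up_to_refinements]
  intro W y
  obtain ⟨W₁, π₁, _, x, hx⟩ := (T.exactAt_c n.castSucc f).lift
    (y ≫ (T.H n.castSucc).map (k (c f))) (by rw [Category.assoc, hF.map_k_comp, Limits.comp_zero])
  obtain ⟨W₂, π₂, _, z, hz⟩ := (exactAt_loopToK_k hF (T.exactAt_k n.castSucc) (c f)).lift
    (π₁ ≫ y - x ≫ (T.H n.castSucc).map (toKCok f)) (by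
      rw [Preadditive.sub_comp, Category.assoc, hx, Category.assoc, ← Functor.map_comp, toKCok_k,
        sub_self])
  -- The class `x'` is the image of `z` under H_n(ΩCf) ≅ H_{n+1}(Cf) → H_{n+1}(ΣX) ≅ H_n(X). It dies
  -- in A, and by the unit coherence it agrees with `z` in H_n(ΩΣX).
  let x' : W₂ ⟶ (T.H n.castSucc).obj X := z ≫ (T.loopObjIso n (Cok f)).hom ≫
    (T.H n.succ).map (cokToSusp f) ≫ (T.suspObjIso n X).inv
  have hx's : x' ≫ (T.suspObjIso n X).hom = z ≫ (T.loopObjIso n (Cok f)).hom ≫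
      (T.H n.succ).map (cokToSusp f) := by
    simp [x']
  have hx'f : x' ≫ (T.H n.castSucc).map f = 0 := by
    rw [← cancel_mono ((T.suspObjIso n A).hom), Category.assoc, map_suspObjIso, reassoc_of% hx's,
      (exactAt_cokToSusp_suspMap hG (T.exactAt_c n.succ) f).choose, Limits.comp_zero,
      Limits.comp_zero, Limits.zero_comp]
  have hx'u : x' ≫ (T.H n.castSucc).map (toLoopSusp X) =
      z ≫ (T.H n.castSucc).map (loopMap (cokToSusp f)) := by
    rw [← cancel_mono ((T.loopObjIso n _).hom), Category.assoc, map_toLoopSusp, hx's,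
      Category.assoc]
    exact congrArg _ (T.map_loopMap_loopObjIso n (cokToSusp f)).symm
  obtain ⟨W₃, π₃, _, z', hz'⟩ := (exactAt_loopToK_k hF (T.exactAt_k n.castSucc) (c f)).lift
    (z ≫ (T.H n.castSucc).map (loopToK (c f)) - x' ≫ (T.H n.castSucc).map (toKCok f)) (by
      rw [Preadditive.sub_comp, Category.assoc, ← Functor.map_comp, loopToK_k, hF.map_zero,
        Category.assoc, ← Functor.map_comp, toKCok_k, hx'f, Limits.comp_zero, sub_self])
  have hz'δ : z' ≫ (T.H n.castSucc).map (loopMap (cokToSusp f)) = 0 := by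
    rw [← loopToK_kCokToLoopSusp, Functor.map_comp, ← Category.assoc, ← hz', Category.assoc,
      Preadditive.sub_comp, Category.assoc, Category.assoc, ← Functor.map_comp,
      ← Functor.map_comp, loopToK_kCokToLoopSusp, toKCok_kCokToLoopSusp, hx'u, sub_self,
      Limits.comp_zero]
  -- The error `z'` vanishes in ΩΣX, so in degree n+1 it comes from A. Hence `z'` comes from ΩA and
  -- dies in K(cf).
  obtain ⟨W₄, π₄, _, a, ha⟩ := (exactAt_c_cokToSusp hG (T.exactAt_c n.succ) f).lift
    (z' ≫ (T.loopObjIso n (Cok f)).hom) (by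
      rw [Category.assoc, ← map_loopMap_loopObjIso, reassoc_of% hz'δ, Limits.zero_comp])
  have hπz' : π₄ ≫ z' ≫ (T.H n.castSucc).map (loopToK (c f)) = 0 := by
    have : π₄ ≫ z' = (a ≫ (T.loopObjIso n A).inv) ≫ (T.H n.castSucc).map (loopMap (c f)) := by
      rw [← cancel_mono ((T.loopObjIso n (Cok f)).hom), Category.assoc, ha, Category.assoc,
        map_loopMap_loopObjIso]
      simp
    rw [reassoc_of% this, (exactAt_loopMap_loopToK hF (T.exactAt_k n.castSucc) (c f)).choose,
      Limits.comp_zero, Limits.comp_zero]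
  refine ⟨W₄, π₄ ≫ π₃ ≫ π₂ ≫ π₁, inferInstance, π₄ ≫ π₃ ≫ (π₂ ≫ x + x'), ?_⟩
  have h₂ : π₂ ≫ π₁ ≫ y = π₂ ≫ x ≫ (T.H n.castSucc).map (toKCok f) +
      z ≫ (T.H n.castSucc).map (loopToK (c f)) := by
    rw [← hz]; simp
  have h₃ : π₃ ≫ z ≫ (T.H n.castSucc).map (loopToK (c f)) =
      π₃ ≫ x' ≫ (T.H n.castSucc).map (toKCok f) +
        z' ≫ (T.H n.castSucc).map (loopToK (c f)) := by
    rw [← hz']; simp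
  simp only [Category.assoc, h₂, Preadditive.comp_add, h₃, hπz', Preadditive.add_comp, add_zero]

theorem epi_map_toKCok (hloop : ∀ X : C, Contractible ((loop C).obj^[p + 1] X))
    (n : Fin (p + 1)) {X A : C} (f : X ⟶ A) : Epi ((T.H n).map (toKCok f)) := by
  induction n using Fin.lastCases with
  | cast n => exact T.epi_map_toKCok_castSucc n f
  | last =>
    have hF := T.hInvariant (Fin.last p)
    rw [epi_iff_surjective_up_to_refinements]
    intro W y
    obtain ⟨W₁, π₁, _, x, hx⟩ := (T.exactAt_c (Fin.last p) f).lift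
      (y ≫ (T.H (Fin.last p)).map (k (c f)))
      (by rw [Category.assoc, hF.map_k_comp, Limits.comp_zero])
    obtain ⟨W₂, π₂, _, z, hz⟩ := (exactAt_loopToK_k hF (T.exactAt_k (Fin.last p)) (c f)).lift
      (π₁ ≫ y - x ≫ (T.H (Fin.last p)).map (toKCok f)) (by
        rw [Preadditive.sub_comp, Category.assoc, hx, Category.assoc, ← Functor.map_comp,
          toKCok_k, sub_self])
    refine ⟨W₁, π₁, inferInstance, x, ?_⟩
    rw [← sub_eq_zero, ← cancel_epi π₂, hz, (T.isZero_loop hloop (Cok f)).eq_of_tgt z 0,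
      Limits.zero_comp, Limits.comp_zero]

/-- A class killed in Y and in ΣKg comes from A, then from Kg, so it is zero. Its image in ΣKg is a
class of Kg one degree lower, which dies in A and so comes from ΩY; the counit coherence shows that
it comes from ΩA, hence is zero. -/
theorem mono_map_fromCokK (hsusp : ∀ X : C, Contractible ((susp C).obj^[p + 1] X))
    (n : Fin (p + 1)) {A Y : C} (g : A ⟶ Y) : Mono ((T.H n).map (fromCokK g)) := by
  have hF := T.hInvariant n
  -- It suffices that the kernel vanishes in `H_n(ΣKg)`.
  suffices H : ∀ (W : D) (y : W ⟶ (T.H n).obj (Cok (k g))), y ≫ (T.H n).map (fromCokK g) = 0 →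
      ∃ (W' : D) (π : W' ⟶ W) (_ : Epi π), π ≫ y ≫ (T.H n).map (cokToSusp (k g)) = 0 by
    refine Preadditive.mono_of_cancel_zero _ fun {W} y hy => ?_
    obtain ⟨W₁, π₁, _, h₁⟩ := H W y hy
    obtain ⟨W₂, π₂, _, a, ha⟩ := (exactAt_c_cokToSusp hF (T.exactAt_c n) (k g)).lift (π₁ ≫ y)
      (by rw [Category.assoc, h₁])
    obtain ⟨W₃, π₃, _, b, hb⟩ := (T.exactAt_k n g).lift a (by
      rw [← c_fromCokK g, Functor.map_comp, ← reassoc_of% ha, hy, Limits.comp_zero,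
        Limits.comp_zero])
    rw [← cancel_epi π₁, ← cancel_epi π₂, ha, ← cancel_epi π₃, reassoc_of% hb, hF.map_comp_c]
    simp
  intro W y hy
  induction n using Fin.cases with
  | zero => exact ⟨W, 𝟙 W, inferInstance, (T.isZero_susp hsusp _).eq_of_tgt _ _⟩
  | succ n =>
    have hF' := T.hInvariant n.castSucc
    let b : W ⟶ (T.H n.castSucc).obj (K g) :=
      (y ≫ (T.H n.succ).map (cokToSusp (k g))) ≫ (T.suspObjIso n (K g)).inv
    have hb : b ≫ (T.suspObjIso n (K g)).hom = y ≫ (T.H n.succ).map (cokToSusp (k g)) := by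
      simp [b]
    have hbk : b ≫ (T.H n.castSucc).map (k g) = 0 := by
      rw [← cancel_mono ((T.suspObjIso n A).hom), Category.assoc, map_suspObjIso, reassoc_of% hb,
        (exactAt_cokToSusp_suspMap hF (T.exactAt_c n.succ) (k g)).choose, Limits.comp_zero,
        Limits.zero_comp]
    obtain ⟨W₁, π₁, _, z, hz⟩ :=
      (exactAt_loopToK_k hF' (T.exactAt_k n.castSucc) g).lift b hbk
    have hzδ : π₁ ≫ y ≫ (T.H n.succ).map (cokToSusp (k g)) = (z ≫ (T.suspObjIso n
        (loopObj Y)).hom) ≫ (T.H n.succ).map (suspMap (loopToK g)) := by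
      rw [← hb, reassoc_of% hz, map_suspObjIso, Category.assoc]
    -- Subtracting the image of `z` under ΣΩY → C(kg) removes the part of `y` seen in ΣKg; the rest
    -- comes from A. As `y` dies in Y, its image there is minus the class of `z`.
    obtain ⟨W₂, π₂, _, a, ha⟩ := (exactAt_c_cokToSusp hF (T.exactAt_c n.succ) (k g)).lift
      (π₁ ≫ y - (z ≫ (T.suspObjIso n (loopObj Y)).hom) ≫ (T.H n.succ).map (suspLoopToCokK g)) (by
        rw [Preadditive.sub_comp, Category.assoc, hzδ, Category.assoc _ _ ((T.H n.succ).map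
          (cokToSusp (k g))), ← Functor.map_comp, suspLoopToCokK_cokToSusp, sub_self])
    have hag : a ≫ (T.H n.succ).map g = -(π₂ ≫ z ≫ (T.loopObjIso n Y).hom) := by
      rw [← T.map_fromSuspLoop n Y, ← c_fromCokK g, Functor.map_comp, ← reassoc_of% ha,
        Preadditive.sub_comp, Category.assoc, hy]
      simp only [Category.assoc]
      rw [← Functor.map_comp, suspLoopToCokK_fromCokK]
      simp
    have hπz : π₂ ≫ z = (-(a ≫ (T.loopObjIso n A).inv)) ≫ (T.H n.castSucc).map (loopMap g) := by
      rw [← cancel_mono ((T.loopObjIso n Y).hom), Category.assoc, Category.assoc,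
        map_loopMap_loopObjIso]
      simp [hag]
    refine ⟨W₂, π₂ ≫ π₁, inferInstance, ?_⟩
    rw [Category.assoc, ← hb, reassoc_of% hz, reassoc_of% hπz,
      reassoc_of% (exactAt_loopMap_loopToK hF' (T.exactAt_k n.castSucc) g).choose]
    simp

end HomologyTheory

/-! ### Comparison maps and the factorizations of u and v -/

namespace HDiffSeq

variable {C : Type u} [Category.{v} C] [PointedHomotopicalCategory.{w} C] (S : HDiffSeq C)

theorem uMap_k : S.uMap ≫ k S.g = S.f := lift_k _ _ _ _

theorem pre_uMap : pre S.uMap (κ S.g) = S.α := pre_lift_κ _ _ _ _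

theorem c_vMap : c S.f ≫ S.vMap = S.g := c_desc _ _ _ _

theorem post_vMap : post (γ S.f) S.vMap = S.α := post_γ_desc _ _ _ _

/-- First kg and γf induce Cu → Cf. Its composite with v restricts to g·kg on Kg, and κg extends to
a nullhomotopy of it because κg·u and v·γf are both α. -/
theorem exists_isComparison : ∃ i : S.leftHomology ⟶ S.rightHomology, S.IsComparison i := by
  have hn : IsNullhomotopy (γ S.f) (S.uMap ≫ k S.g ≫ c S.f) := by
    rw [← Category.assoc, uMap_k]; exact γ_isNull S.f
  have hj := c_desc S.uMap (k S.g ≫ c S.f) (γ S.f) hn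
  have hj' := post_γ_desc S.uMap (k S.g ≫ c S.f) (γ S.f) hn
  generalize desc S.uMap (k S.g ≫ c S.f) (γ S.f) hn = j at hj hj'
  obtain ⟨ξ, hξ, hξ'⟩ := exists_nullhomotopy_desc (j ≫ S.vMap) (κ S.g)
    (by rw [reassoc_of% hj, c_vMap]; exact κ_isNull S.g)
    (two_of_eq (by rw [pre_uMap, post_comp, hj', post_vMap]))
  refine ⟨lift S.vMap j ξ hξ, ?_, ?_, ?_⟩
  · rw [lift_k, hj]
  · rw [← post_comp, lift_k, hj']
  · rw [pre_lift_κ, hξ']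

theorem IsComparison.comp_cokToSusp {S : HDiffSeq C} {i : S.leftHomology ⟶ S.rightHomology}
    (hi : S.IsComparison i) : (i ≫ k S.vMap) ≫ cokToSusp S.f = cokToSusp S.uMap := by
  refine Cok_hom_ext ?_ ?_
  · rw [← Category.assoc, hi.comm, Category.assoc, c_cokToSusp, c_cokToSusp, comp_zeroMap]
  · rw [post_comp, post_comp, hi.post_γ, post_cokToSusp, post_cokToSusp]

/-- The map `K(cf) ⟶ Kg` induced by `v_α`. -/
noncomputable def kCokToK : K (c S.f) ⟶ K S.g :=
  lift S.g (k (c S.f)) (post (κ (c S.f)) S.vMap) (by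
    have h := (κ_isNull (c S.f)).post S.vMap
    rwa [Category.assoc, c_vMap] at h)

theorem kCokToK_k : S.kCokToK ≫ k S.g = k (c S.f) := lift_k _ _ _ _

theorem pre_kCokToK : pre S.kCokToK (κ S.g) = post (κ (c S.f)) S.vMap := pre_lift_κ _ _ _ _

theorem toKCok_kCokToK : toKCok S.f ≫ S.kCokToK = S.uMap :=
  K_hom_ext (by rw [Category.assoc, kCokToK_k, toKCok_k, uMap_k])
    (by rw [pre_comp, pre_kCokToK, pre_post, pre_toKCok, post_vMap, pre_uMap])

/-- The map `Cf ⟶ C(kg)` induced by `u_α`. -/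
noncomputable def cokToCokK : Cok S.f ⟶ Cok (k S.g) :=
  desc S.f (c (k S.g)) (pre S.uMap (γ (k S.g))) (by
    have h := (γ_isNull (k S.g)).pre S.uMap
    rwa [← Category.assoc, uMap_k] at h)

theorem c_cokToCokK : c S.f ≫ S.cokToCokK = c (k S.g) := c_desc _ _ _ _

theorem post_cokToCokK : post (γ S.f) S.cokToCokK = pre S.uMap (γ (k S.g)) := post_γ_desc _ _ _ _

theorem cokToCokK_fromCokK : S.cokToCokK ≫ fromCokK S.g = S.vMap :=
  Cok_hom_ext (by rw [← Category.assoc, c_cokToCokK, c_fromCokK, c_vMap])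
    (by rw [post_comp, post_cokToCokK, ← pre_post, post_fromCokK, pre_uMap, post_vMap])

theorem IsComparison.loopToK_comp {S : HDiffSeq C} {i : S.leftHomology ⟶ S.rightHomology}
    (hi : S.IsComparison i) : loopToK S.g ≫ c S.uMap ≫ i = loopToK S.vMap := by
  refine K_hom_ext ?_ ?_
  · rw [Category.assoc, Category.assoc, hi.comm, ← Category.assoc, loopToK_k, loopToK_k,
      zeroMap_comp]
  · rw [pre_comp, pre_comp, hi.pre_κ, pre_loopToK, pre_loopToK]

end HDiffSeq

/-! ### Comparison maps are weak equivalences -/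

namespace HomologyTheory

variable {C : Type u} [Category.{v} C] [PointedHomotopicalCategory.{w} C]
  {D : Type u'} [Category.{v'} D] [Abelian D] {p : ℕ} (T : HomologyTheory C D p)
  {S : HDiffSeq C} {i : S.leftHomology ⟶ S.rightHomology}

theorem mono_map_of_isComparison (hloop : ∀ X : C, Contractible ((loop C).obj^[p + 1] X))
    (hi : S.IsComparison i) (n : Fin (p + 1)) : Mono ((T.H n).map i) := by
  have hF := T.hInvariant n
  refine Preadditive.mono_of_cancel_zero _ fun {W} x hx => ?_
  obtain ⟨W₁, π₁, _, y, hy⟩ := (exactAt_c_cokToSusp hF (T.exactAt_c n) S.uMap).lift x (by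
    rw [← hi.comp_cokToSusp, Functor.map_comp, Functor.map_comp, Category.assoc,
      reassoc_of% hx, Limits.zero_comp])
  obtain ⟨W₂, π₂, _, z, hz⟩ := (exactAt_K_comp hF (T.exactAt_k n) S.kCokToK_k S.pre_kCokToK
    (m := c S.uMap ≫ i) (by rw [Category.assoc, hi.comm]) (by rw [pre_comp, hi.pre_κ])).lift y (by
      rw [Functor.map_comp, ← reassoc_of% hy, hx, Limits.comp_zero])
  have := T.epi_map_toKCok hloop n S.f
  obtain ⟨W₃, π₃, _, t, ht⟩ :=
    surjective_up_to_refinements_of_epi ((T.H n).map (toKCok S.f)) z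
  rw [← cancel_epi π₁, ← cancel_epi π₂, ← cancel_epi π₃, hy, reassoc_of% hz, reassoc_of% ht,
    ← Functor.map_comp_assoc, S.toKCok_kCokToK, hF.map_comp_c]
  simp

theorem epi_map_of_isComparison (hsusp : ∀ X : C, Contractible ((susp C).obj^[p + 1] X))
    (hi : S.IsComparison i) (n : Fin (p + 1)) : Epi ((T.H n).map i) := by
  have hF := T.hInvariant n
  rw [epi_iff_surjective_up_to_refinements]
  intro W x
  have := T.mono_map_fromCokK hsusp n S.g
  obtain ⟨W₁, π₁, _, y, hy⟩ := (exactAt_Cok_comp hF (T.exactAt_c n) S.c_cokToCokK S.post_cokToCokK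
    (m := i ≫ k S.vMap) hi.comm (by rw [post_comp, hi.post_γ])).lift
    (x ≫ (T.H n).map (k S.vMap)) (by
      rw [← cancel_mono ((T.H n).map (fromCokK S.g)), Category.assoc, Category.assoc,
        ← Functor.map_comp, S.cokToCokK_fromCokK, hF.map_k_comp, Limits.comp_zero,
        Limits.zero_comp])
  -- The error dies in Cf, so it comes from ΩY; the map ΩY → Kv factors through `i` by
  -- `loopToK_comp`.
  obtain ⟨W₂, π₂, _, z, hz⟩ := (exactAt_loopToK_k hF (T.exactAt_k n) S.vMap).lift
    (π₁ ≫ x - y ≫ (T.H n).map i) (by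
      rw [Preadditive.sub_comp, Category.assoc, hy, Category.assoc, ← Functor.map_comp, sub_self])
  refine ⟨W₂, π₂ ≫ π₁, inferInstance,
    π₂ ≫ y + z ≫ (T.H n).map (loopToK S.g) ≫ (T.H n).map (c S.uMap), ?_⟩
  rw [Preadditive.comp_sub, sub_eq_iff_eq_add, ← hi.loopToK_comp] at hz
  rw [Category.assoc, hz]
  simp [add_comm]

end HomologyTheory

end Homotopical

theorem lemma3p8 {C : Type u} [Category.{v} C] [PointedHomotopicalCategory.{w} C]
    {D : Type u'} [Category.{v'} D] [Abelian D] (p : ℕ)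
    (hloop : ∀ X : C, Contractible ((loop C).obj^[p + 1] X))
    (hsusp : ∀ X : C, Contractible ((susp C).obj^[p + 1] X))
    (T : HomologyTheory C D p) (S : HDiffSeq C) :
    (∃ i : S.leftHomology ⟶ S.rightHomology, S.IsComparison i) ∧
      ∀ i : S.leftHomology ⟶ S.rightHomology, S.IsComparison i → T.WeakEquivalence i := by
  refine ⟨S.exists_isComparison, fun i hi n => ?_⟩
  have := T.mono_map_of_isComparison hloop hi n
  have := T.epi_map_of_isComparison hsusp hi n
  exact isIso_of_mono_of_epi _
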